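/- Let $Z$ be a complex manifold, $X$ and $M$ smooth manifolds, and let $Z\xleftarrow{\eta}X\xrightarrow{\tau}M$ be a smooth double fibration: $\eta$ and $\tau$ are smooth submersions and the fibres of $\tau$ are embedded by $\eta$ as compact complex submanifolds of $Z$. Write $\Lambda_X^1$ for the bundle of complex-valued $1$-forms on $X$, $\Lambda_\tau^1=\Lambda_\tau^{1,0}\oplus\Lambda_\tau^{0,1}$ for the bundle of complex-valued $1$-forms along the fibres of $\tau$, split by the complex structure that these fibres acquire from $Z$ by means of $\eta$, and let the bundle $\Lambda_\mu^{1,0}$ on $X$ be the middle cohomology $\ker/\operatorname{im}$ at $\Lambda^1_X$ of the complex $$0\to\eta^*\Lambda_Z^{1,0}\to\Lambda_X^1\to\Lambda_\tau^{0,1}\to 0,$$ where the first map is pull-back by $\eta$ and the second is restriction to the fibres of $\tau$ followed by projection to type $(0,1)$. Let $Z\xleftarrow{\mu}\mathbb{X}\xrightarrow{\nu}\mathbb{M}$ be a double fibration in the holomorphic category: $\mathbb{X}$ and $\mathbb{M}$ are complex manifolds and $\mu,\nu$ are holomorphic submersions. Suppose that the smooth double fibration embeds in it: there are smooth embeddings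 $\iota:X\hookrightarrow\mathbb{X}$ and $j:M\hookrightarrow\mathbb{M}$ with $\mu\circ\iota=\eta$ and $\nu\circ\iota=j\circ\tau$. Suppose that $M$ is (maximally) totally real in $\mathbb{M}$, that is, $T_{j(m)}\mathbb{M}=dj(T_mM)\oplus i\,dj(T_mM)$ for all $m\in M$, and that the fibres of $\nu$ coincide with those of $\tau$ over $M$, that is, $\iota(\tau^{-1}(m))=\nu^{-1}(j(m))$ for all $m\in M$. Then the bundle $\Lambda_\mu^{1,0}$ of $(1,0)$-forms along the fibres of $\mu$ on $\mathbb{X}$, when restricted to $X\subset\mathbb{X}$, coincides with the middle cohomology bundle $\Lambda_\mu^{1,0}$ on $X$. More precisely, pull-back of forms by $\iota$ induces an isomorphism of smooth complex vector bundles: for $x\in X$ and a $(1,0)$-form $\xi$ on $T_{\iota(x)}\mathbb{X}$, the form $\iota^*\xi$ lies in the kernel of $\Lambda_X^1\to\Lambda_\tau^{0,1}$, and the restriction of $\xi$ to the fibre of $\mu$ corresponds to the class of $\iota^*\xi$. This is a complex linear isomorphism at each $x\in X$, and a section over an open subset of $X$ is smooth if and only if its image is. -/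

import Mathlib

open scoped Manifold ContDiff
open Bundle

noncomputable section

namespace DoubleFibration

/-! ### Complex manifolds, complex-valued 1-forms

A complex manifold is a manifold modelled on `𝓘(ℂ, E)` with holomorphic (that is, complex analytic)
changes of charts; the same atlas, read over `𝓘(ℝ, E)`, is its underlying smooth manifold. -/

/-- The smooth manifold underlying a complex manifold. -/
instance isManifold_real_of_complex {E : Type*} [NormedAddCommGroup E] [NormedSpace ℂ E]
    {M : Type*} [TopologicalSpace M] [ChartedSpace E M] [h : IsManifold 𝓘(ℂ, E) ω M] :
    IsManifold 𝓘(ℝ, E) ω M := by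
  refine isManifold_of_contDiffOn 𝓘(ℝ, E) ω M fun e e' he he' => ?_
  have h1 := (contDiffGroupoid ω 𝓘(ℂ, E)).compatible he he'
  rw [contDiffGroupoid, mem_groupoid_of_pregroupoid] at h1
  exact ContDiffOn.restrict_scalars ℝ h1.1

section Cohomology

variable {A B C : Type*} [AddCommMonoid A] [Module ℂ A] [AddCommGroup B] [Module ℂ B]
  [AddCommMonoid C] [Module ℂ C]

/-- The cohomology `ker g / im f` of a complex `A → B → C` of complex vector spaces. -/
abbrev Cohomology (f : A →ₗ[ℂ] B) (g : B →ₗ[ℂ] C) : Type _ :=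
  LinearMap.ker g ⧸ (LinearMap.range f).submoduleOf (LinearMap.ker g)

/-- The cohomology class of an element of `ker g`. -/
def cohomologyClass (f : A →ₗ[ℂ] B) (g : B →ₗ[ℂ] C) (b : B) (hb : g b = 0) : Cohomology f g :=
  Submodule.Quotient.mk ⟨b, LinearMap.mem_ker.2 hb⟩

end Cohomology

section Forms

variable {E : Type*} [NormedAddCommGroup E] [NormedSpace ℝ E]
  {M : Type*} [TopologicalSpace M] [ChartedSpace E M]

/-- `Λ¹` at `x`: the complex-valued (real linear) 1-forms at a point of a smooth manifold. -/
abbrev Form1 (E : Type*) [NormedAddCommGroup E] [NormedSpace ℝ E]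
    {M : Type*} [TopologicalSpace M] [ChartedSpace E M] (x : M) : Type _ :=
  TangentSpace 𝓘(ℝ, E) x →L[ℝ] ℂ

/-- A family `α x` of complex-valued 1-forms of `N` at the points `f x`, that is, a section of
the pull-back to `M` of the bundle of complex-valued 1-forms of `N`, is smooth on `U`.
For `f = id` these are the smooth complex-valued 1-forms on `U`. -/
def IsSmoothAlong {E' : Type*} [NormedAddCommGroup E'] [NormedSpace ℝ E']
    {N : Type*} [TopologicalSpace N] [ChartedSpace E' N] [IsManifold 𝓘(ℝ, E') ∞ N]
    (f : M → N) (α : ∀ x : M, Form1 E' (f x)) (U : Set M) : Prop :=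
  ContMDiffOn 𝓘(ℝ, E) (𝓘(ℝ, E').prod 𝓘(ℝ, E' →L[ℝ] ℂ)) ∞
    (fun x => TotalSpace.mk' (E' →L[ℝ] ℂ)
      (E := fun y : N => TangentSpace 𝓘(ℝ, E') y →L[ℝ] Trivial N ℂ y) (f x) (α x)) U

end Forms

section Complex

variable {E : Type*} [NormedAddCommGroup E] [NormedSpace ℂ E]
  {M : Type*} [TopologicalSpace M] [ChartedSpace E M]

/-- The complex structure (multiplication by `i`) on the real tangent spaces of a complex
manifold. -/
def J (z : M) : TangentSpace 𝓘(ℝ, E) z →L[ℝ] TangentSpace 𝓘(ℝ, E) z :=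
  (Complex.I • ContinuousLinearMap.id ℝ E : E →L[ℝ] E)

lemma J_J (z : M) (v : TangentSpace 𝓘(ℝ, E) z) : J z (J z v) = -v := by
  change Complex.I • Complex.I • (show E from v) = -(show E from v)
  rw [smul_smul, Complex.I_mul_I, neg_one_smul]

/-- `Λ^{1,0}` at `z`: the forms of type `(1,0)` among the complex-valued 1-forms. -/
def Form10 (E : Type*) [NormedAddCommGroup E] [NormedSpace ℂ E]
    {M : Type*} [TopologicalSpace M] [ChartedSpace E M] (z : M) : Submodule ℂ (Form1 E z) where
  carrier := {β | ∀ v, β (J z v) = Complex.I * β v}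
  add_mem' {a b} ha hb v := by
    simp only [Set.mem_ofPred_eq] at ha hb
    simp only [add_apply, ha v, hb v]; ring
  zero_mem' v := by simp
  smul_mem' c a ha v := by
    simp only [Set.mem_ofPred_eq] at ha
    simp only [smul_apply, ha v, smul_eq_mul]; ring

end Complex

section Pullback

variable {E : Type*} [NormedAddCommGroup E] [NormedSpace ℝ E]
  {M : Type*} [TopologicalSpace M] [ChartedSpace E M]
  {E' : Type*} [NormedAddCommGroup E'] [NormedSpace ℝ E']
  {N : Type*} [TopologicalSpace N] [ChartedSpace E' N]

/-- Pull-back of complex-valued 1-forms along `f`, at the point `x`. -/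
def pullback (f : M → N) (x : M) : Form1 E' (f x) →ₗ[ℂ] Form1 E x where
  toFun α := α.comp (mfderiv 𝓘(ℝ, E) 𝓘(ℝ, E') f x)
  map_add' _ _ := rfl
  map_smul' _ _ := rfl

/-- The vertical tangent space of `f` at `x`: the vectors tangent to the fibre of `f`. -/
abbrev Vert (E E' : Type*) [NormedAddCommGroup E] [NormedSpace ℝ E]
    {M : Type*} [TopologicalSpace M] [ChartedSpace E M]
    [NormedAddCommGroup E'] [NormedSpace ℝ E']
    {N : Type*} [TopologicalSpace N] [ChartedSpace E' N] (f : M → N) (x : M) :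
    Submodule ℝ (TangentSpace 𝓘(ℝ, E) x) :=
  (mfderiv 𝓘(ℝ, E) 𝓘(ℝ, E') f x).ker

/-- `Λ¹_f` at `x`: the complex-valued 1-forms along the fibres of `f`. -/
abbrev VertForm1 (E E' : Type*) [NormedAddCommGroup E] [NormedSpace ℝ E]
    {M : Type*} [TopologicalSpace M] [ChartedSpace E M]
    [NormedAddCommGroup E'] [NormedSpace ℝ E']
    {N : Type*} [TopologicalSpace N] [ChartedSpace E' N] (f : M → N) (x : M) : Type _ :=
  Vert E E' f x →L[ℝ] ℂ

/-- Restriction `Λ¹ → Λ¹_f` of 1-forms to the fibres of `f`. -/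
def restrictVert (f : M → N) (x : M) : Form1 E x →ₗ[ℂ] VertForm1 E E' f x where
  toFun α := α.comp (Vert E E' f x).subtypeL
  map_add' _ _ := rfl
  map_smul' _ _ := rfl

end Pullback

section Double

variable {EZ EX EM : Type*}
  [NormedAddCommGroup EZ] [NormedSpace ℂ EZ]
  [NormedAddCommGroup EX] [NormedSpace ℝ EX]
  [NormedAddCommGroup EM] [NormedSpace ℝ EM]
  {Z X M : Type*}
  [TopologicalSpace Z] [ChartedSpace EZ Z]
  [TopologicalSpace X] [ChartedSpace EX X]
  [TopologicalSpace M] [ChartedSpace EM M]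

/-- A double fibration `Z ← X → M` of smooth manifolds, with `Z` a complex manifold, such that the
fibres of `τ` are embedded by `η` as compact complex submanifolds of `Z`. -/
structure IsSmoothDoubleFibration (EZ EX EM : Type*)
    [NormedAddCommGroup EZ] [NormedSpace ℂ EZ]
    [NormedAddCommGroup EX] [NormedSpace ℝ EX]
    [NormedAddCommGroup EM] [NormedSpace ℝ EM]
    {Z X M : Type*}
    [TopologicalSpace Z] [ChartedSpace EZ Z]
    [TopologicalSpace X] [ChartedSpace EX X]
    [TopologicalSpace M] [ChartedSpace EM M] (η : X → Z) (τ : X → M) : Prop where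
  submersion_left : Manifold.IsSubmersion 𝓘(ℝ, EX) 𝓘(ℝ, EZ) ∞ η
  submersion_right : Manifold.IsSubmersion 𝓘(ℝ, EX) 𝓘(ℝ, EM) ∞ τ
  compact_fibre : ∀ m : M, IsCompact (τ ⁻¹' {m})
  /-- `η` embeds the fibres of `τ` topologically, … -/
  embedding_fibre : ∀ m : M, Topology.IsEmbedding (fun y : τ ⁻¹' {m} => η y)
  /-- … it is immersive along them, … -/
  injective_fibre : ∀ x : X, ∀ v ∈ Vert EX EM τ x, mfderiv 𝓘(ℝ, EX) 𝓘(ℝ, EZ) η x v = 0 → v = 0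
  /-- … and the tangent spaces of their images are complex subspaces. -/
  complex_fibre : ∀ x : X, ∀ v ∈ Vert EX EM τ x, ∃ w ∈ Vert EX EM τ x,
    mfderiv 𝓘(ℝ, EX) 𝓘(ℝ, EZ) η x w = J (η x) (mfderiv 𝓘(ℝ, EX) 𝓘(ℝ, EZ) η x v)

variable {η : X → Z} {τ : X → M}

namespace IsSmoothDoubleFibration

/-- The differential of `η` along the fibre of `τ`. -/
def dEta (_h : IsSmoothDoubleFibration EZ EX EM η τ) (x : X) :
    Vert EX EM τ x →ₗ[ℝ] TangentSpace 𝓘(ℝ, EZ) (η x) :=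
  (mfderiv 𝓘(ℝ, EX) 𝓘(ℝ, EZ) η x).toLinearMap.comp (Vert EX EM τ x).subtype

lemma dEta_injective (h : IsSmoothDoubleFibration EZ EX EM η τ) (x : X) :
    Function.Injective (h.dEta x) := by
  rw [injective_iff_map_eq_zero]
  intro v hv
  exact Subtype.ext (h.injective_fibre x v v.2 hv)

/-- The complex structure on the tangent spaces of the fibres of `τ`, acquired from that of `Z` by
means of `η`. -/
def fibreJ (h : IsSmoothDoubleFibration EZ EX EM η τ) (x : X) :
    Vert EX EM τ x →ₗ[ℝ] Vert EX EM τ x :=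
  (LinearEquiv.ofInjective (h.dEta x) (h.dEta_injective x)).symm.toLinearMap.comp
    (((J (η x)).toLinearMap.comp (h.dEta x)).codRestrict (LinearMap.range (h.dEta x)) fun v => by
      obtain ⟨w, hw, hwv⟩ := h.complex_fibre x v v.2
      exact ⟨⟨w, hw⟩, hwv⟩)

lemma dEta_fibreJ (h : IsSmoothDoubleFibration EZ EX EM η τ) (x : X) (v : Vert EX EM τ x) :
    h.dEta x (h.fibreJ x v) = J (η x) (h.dEta x v) := by
  have := LinearEquiv.apply_symm_apply (LinearEquiv.ofInjective (h.dEta x) (h.dEta_injective x))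
    ((((J (η x)).toLinearMap.comp (h.dEta x)).codRestrict (LinearMap.range (h.dEta x)) fun v => by
      obtain ⟨w, hw, hwv⟩ := h.complex_fibre x v v.2
      exact ⟨⟨w, hw⟩, hwv⟩) v)
  exact congrArg Subtype.val this

lemma fibreJ_fibreJ (h : IsSmoothDoubleFibration EZ EX EM η τ) (x : X) (v : Vert EX EM τ x) :
    h.fibreJ x (h.fibreJ x v) = -v := by
  apply h.dEta_injective x
  rw [dEta_fibreJ, dEta_fibreJ, J_J, map_neg]

variable [FiniteDimensional ℝ EX]

instance (x : X) : FiniteDimensional ℝ (TangentSpace 𝓘(ℝ, EX) x) :=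
  inferInstanceAs (FiniteDimensional ℝ EX)

instance (x : X) : T2Space (TangentSpace 𝓘(ℝ, EX) x) :=
  inferInstanceAs (T2Space EX)

/-- `Λ_τ^{0,1}` at `x`: the forms of type `(0,1)` among the 1-forms along the fibres of `τ`. -/
def vertForm01 (h : IsSmoothDoubleFibration EZ EX EM η τ) (x : X) :
    Submodule ℂ (VertForm1 EX EM τ x) where
  carrier := {β | ∀ v, β (h.fibreJ x v) = -Complex.I * β v}
  add_mem' {a b} ha hb v := by
    simp only [Set.mem_ofPred_eq] at ha hb
    simp only [add_apply, ha v, hb v]; ring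
  zero_mem' v := by simp
  smul_mem' c a ha v := by
    simp only [Set.mem_ofPred_eq] at ha
    simp only [smul_apply, ha v, smul_eq_mul]; ring

/-- The projection `Λ_τ¹ = Λ_τ^{0,1} ⊕ Λ_τ^{1,0} → Λ_τ^{0,1}`, `α ↦ (α + i α ∘ J) / 2`. -/
def proj01 (h : IsSmoothDoubleFibration EZ EX EM η τ) (x : X) :
    VertForm1 EX EM τ x →ₗ[ℂ] h.vertForm01 x where
  toFun α := ⟨(1 / 2 : ℂ) • (α + Complex.I • α.comp (LinearMap.toContinuousLinearMap (h.fibreJ x))),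
    fun v => by
      simp only [smul_apply, add_apply,
        ContinuousLinearMap.comp_apply, LinearMap.coe_toContinuousLinearMap', fibreJ_fibreJ,
        map_neg, smul_eq_mul]
      linear_combination ((1 / 2 : ℂ) * α (h.fibreJ x v)) * Complex.I_mul_I⟩
  map_add' a b := by
    ext v
    simp only [Submodule.coe_add, smul_apply, add_apply,
      ContinuousLinearMap.comp_apply, smul_eq_mul]
    ring
  map_smul' c a := by
    ext v
    simp only [Submodule.coe_smul, smul_apply, add_apply,
      ContinuousLinearMap.comp_apply, smul_eq_mul, RingHom.id_apply]
    ring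

/-- The first map `η^* Λ_Z^{1,0} → Λ_X¹` of the complex
`0 → η^* Λ_Z^{1,0} → Λ_X¹ → Λ_τ^{0,1} → 0`. -/
def complexFst (_h : IsSmoothDoubleFibration EZ EX EM η τ) (x : X) :
    Form10 EZ (η x) →ₗ[ℂ] Form1 EX x :=
  (pullback η x).comp (Form10 EZ (η x)).subtype

/-- The second map `Λ_X¹ → Λ_τ^{0,1}` of the complex
`0 → η^* Λ_Z^{1,0} → Λ_X¹ → Λ_τ^{0,1} → 0`. -/
def complexSnd (h : IsSmoothDoubleFibration EZ EX EM η τ) (x : X) :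
    Form1 EX x →ₗ[ℂ] h.vertForm01 x :=
  (h.proj01 x).comp (restrictVert τ x)

lemma complexSnd_complexFst (h : IsSmoothDoubleFibration EZ EX EM η τ) (x : X)
    (β : Form10 EZ (η x)) : h.complexSnd x (h.complexFst x β) = 0 := by
  ext v
  have h2 : (β : Form1 EZ (η x)) (h.dEta x (h.fibreJ x v)) = Complex.I * β.1 (h.dEta x v) := by
    rw [dEta_fibreJ]; exact β.2 _
  change (1 / 2 : ℂ) * (β.1 (h.dEta x v) + Complex.I * β.1 (h.dEta x (h.fibreJ x v))) = 0
  rw [h2]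
  linear_combination ((1 / 2 : ℂ) * β.1 (h.dEta x v)) * Complex.I_mul_I

/-- The fibre at `x` of the bundle defined as the middle cohomology of
`0 → η^* Λ_Z^{1,0} → Λ_X¹ → Λ_τ^{0,1} → 0`. -/
abbrev MiddleCohomology (h : IsSmoothDoubleFibration EZ EX EM η τ) (x : X) : Type _ :=
  Cohomology (h.complexFst x) (h.complexSnd x)

/-- The class in the middle cohomology of a 1-form in the kernel of `Λ_X¹ → Λ_τ^{0,1}`. -/
def middleClass (h : IsSmoothDoubleFibration EZ EX EM η τ) (x : X) (α : Form1 EX x)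
    (hα : h.complexSnd x α = 0) : h.MiddleCohomology x :=
  cohomologyClass (h.complexFst x) (h.complexSnd x) α hα

/-- The smooth structure of the middle cohomology bundle: a section is smooth on `U` when it is
locally represented by smooth 1-forms on `X` in the kernel of `Λ_X¹ → Λ_τ^{0,1}`. -/
def IsSmoothSection [IsManifold 𝓘(ℝ, EX) ∞ X] (h : IsSmoothDoubleFibration EZ EX EM η τ)
    (s : ∀ x, h.MiddleCohomology x) (U : Set X) : Prop :=
  ∀ x₀ ∈ U, ∃ V : Set X, IsOpen V ∧ x₀ ∈ V ∧ ∃ α : ∀ x, Form1 EX x,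
    IsSmoothAlong (E := EX) (E' := EX) (id : X → X) α V ∧ ∀ x ∈ V, ∃ hα : h.complexSnd x (α x) = 0, s x = h.middleClass x (α x) hα

end IsSmoothDoubleFibration

end Double

section Holomorphic

variable {EZ EXX : Type*}
  [NormedAddCommGroup EZ] [NormedSpace ℂ EZ] [NormedAddCommGroup EXX] [NormedSpace ℂ EXX]
  {Z XX : Type*}
  [TopologicalSpace Z] [ChartedSpace EZ Z] [TopologicalSpace XX] [ChartedSpace EXX XX]

/-- A double fibration in the holomorphic category: both maps are holomorphic submersions. -/
structure IsHolomorphicDoubleFibration (EZ EXX EMM : Type*)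
    [NormedAddCommGroup EZ] [NormedSpace ℂ EZ]
    [NormedAddCommGroup EXX] [NormedSpace ℂ EXX]
    [NormedAddCommGroup EMM] [NormedSpace ℂ EMM]
    {Z XX MM : Type*}
    [TopologicalSpace Z] [ChartedSpace EZ Z]
    [TopologicalSpace XX] [ChartedSpace EXX XX]
    [TopologicalSpace MM] [ChartedSpace EMM MM] (μ : XX → Z) (ν : XX → MM) : Prop where
  submersion_left : Manifold.IsSubmersion 𝓘(ℂ, EXX) 𝓘(ℂ, EZ) ω μ
  submersion_right : Manifold.IsSubmersion 𝓘(ℂ, EXX) 𝓘(ℂ, EMM) ω ν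

/-- `Λ_μ^{1,0}` at `p`: the forms of type `(1,0)` along the fibres of `μ`. -/
def VertForm10 (EZ EXX : Type*)
    [NormedAddCommGroup EZ] [NormedSpace ℂ EZ] [NormedAddCommGroup EXX] [NormedSpace ℂ EXX]
    {Z XX : Type*}
    [TopologicalSpace Z] [ChartedSpace EZ Z] [TopologicalSpace XX] [ChartedSpace EXX XX]
    (μ : XX → Z) (p : XX) : Submodule ℂ (VertForm1 EXX EZ μ p) where
  carrier := {β | ∀ v w : Vert EXX EZ μ p, w.1 = J p v.1 → β w = Complex.I * β v}
  add_mem' {a b} ha hb v w hvw := by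
    simp only [Set.mem_ofPred_eq] at ha hb
    simp only [add_apply, ha v w hvw, hb v w hvw]; ring
  zero_mem' v w _ := by simp
  smul_mem' c a ha v w hvw := by
    simp only [Set.mem_ofPred_eq] at ha
    simp only [smul_apply, ha v w hvw, smul_eq_mul]; ring

/-- Restriction `Λ_𝕏^{1,0} → Λ_μ^{1,0}` to the fibres of `μ`. -/
def restrict10 (μ : XX → Z) (p : XX) : Form10 EXX p →ₗ[ℂ] VertForm10 EZ EXX μ p :=
  ((restrictVert μ p).comp (Form10 EXX p).subtype).codRestrict _ fun ξ v w hvw => by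
    change ξ.1 w.1 = Complex.I * ξ.1 v.1
    rw [hvw]
    exact ξ.2 v.1

/-- The smooth structure of the restriction to `X` (along `ι : X → 𝕏`) of `Λ_μ^{1,0}`: a section is
smooth on `U` when it is locally the restriction to the fibres of `μ` of a smooth section along
`ι` of the bundle of `(1,0)`-forms of `𝕏`. -/
def IsSmoothVertSection {EX : Type*} [NormedAddCommGroup EX] [NormedSpace ℝ EX]
    {X : Type*} [TopologicalSpace X] [ChartedSpace EX X] [IsManifold 𝓘(ℂ, EXX) ω XX]
    (ι : X → XX) (μ : XX → Z) (s : ∀ x, VertForm10 EZ EXX μ (ι x)) (U : Set X) : Prop :=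
  ∀ x₀ ∈ U, ∃ V : Set X, IsOpen V ∧ x₀ ∈ V ∧ ∃ ξ : ∀ x, Form10 EXX (ι x),
    IsSmoothAlong (E := EX) ι (fun x => (ξ x).1) V ∧ ∀ x ∈ V, s x = restrict10 μ (ι x) (ξ x)

/-- The smooth map `j : M → 𝕄` is an embedding onto a (maximally) totally real submanifold:
`T𝕄 = TM ⊕ i TM` along `M`. -/
structure IsTotallyReal (EM EMM : Type*) [NormedAddCommGroup EM] [NormedSpace ℝ EM]
    [NormedAddCommGroup EMM] [NormedSpace ℂ EMM]
    {M MM : Type*} [TopologicalSpace M] [ChartedSpace EM M]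
    [TopologicalSpace MM] [ChartedSpace EMM MM] (j : M → MM) : Prop where
  embedding : Manifold.IsSmoothEmbedding 𝓘(ℝ, EM) 𝓘(ℝ, EMM) ∞ j
  isCompl : ∀ m : M, IsCompl (mfderiv 𝓘(ℝ, EM) 𝓘(ℝ, EMM) j m).range
    ((mfderiv 𝓘(ℝ, EM) 𝓘(ℝ, EMM) j m).range.map (J (j m)).toLinearMap)

/-- `Z ← X → M` embeds in `Z ← 𝕏 → 𝕄` (by the identity of `Z`, by `ι : X → 𝕏` and `j : M → 𝕄`)
with `M` totally real in `𝕄`, and the fibres of `ν` coincide with those of `τ` over `M`. -/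
structure IsComplexification (EX EM EXX EMM : Type*)
    [NormedAddCommGroup EX] [NormedSpace ℝ EX] [NormedAddCommGroup EM] [NormedSpace ℝ EM]
    [NormedAddCommGroup EXX] [NormedSpace ℂ EXX] [NormedAddCommGroup EMM] [NormedSpace ℂ EMM]
    {Z X M XX MM : Type*}
    [TopologicalSpace X] [ChartedSpace EX X]
    [TopologicalSpace M] [ChartedSpace EM M]
    [TopologicalSpace XX] [ChartedSpace EXX XX]
    [TopologicalSpace MM] [ChartedSpace EMM MM]
    (η : X → Z) (τ : X → M) (μ : XX → Z) (ν : XX → MM) (ι : X → XX) (j : M → MM) : Prop where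
  embedding : Manifold.IsSmoothEmbedding 𝓘(ℝ, EX) 𝓘(ℝ, EXX) ∞ ι
  totallyReal : IsTotallyReal EM EMM j
  comm_left : ∀ x, μ (ι x) = η x
  comm_right : ∀ x, ν (ι x) = j (τ x)
  fibres : ∀ m : M, ι '' (τ ⁻¹' {m}) = ν ⁻¹' {j m}

end Holomorphic

end DoubleFibration

end

/-!
Fix `x : X`, write `T`, `TX`, `TM`, `T𝕄` for the tangent spaces of `𝕏`, `X`, `M`, `𝕄` at the
points determined by `x`, and identify `TX` with its image in `T`.

Everything follows from the fact that pull-back by `ι` is an isomorphism of `Λ_𝕏^{1,0}` at `ι x`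
with the kernel of `Λ_X¹ → Λ_τ^{0,1}` at `x`. The point is the position of `TX` in the complex
vector space `T`. Since the fibres of `τ` and `ν` coincide as sets, their tangent spaces coincide:
`ker dν ⊆ TX` is the space `V` tangent to the fibre of `τ`
(`IsComplexification.exists_vert_of_realDeriv_right_eq_zero`). Modulo `V`, the inclusion of `TX`
in `T` becomes by `dν` the inclusion of `TM` in `T𝕄 = TM ⊕ i TM`. Hence `TX + i TX = T` and
`TX ∩ i TX = V` (`IsComplexification.exists_eq_add_smul` and
`IsComplexification.mem_vert_of_add_smul_eq_zero`). So a complex-valued real linear form on `TX`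
extends to a complex linear form on `T` precisely when it is complex linear on `V`, and the
extension is unique. The complex structure of `V ⊆ T` is the one that `V` acquires from `Z`,
because `μ` is holomorphic and `η` is immersive along the fibres of `τ`
(`IsComplexification.realDeriv_fibreJ`), so complex linearity on `V` is the condition that defines
the kernel.

Under this isomorphism the image of `η^* Λ_Z^{1,0}` corresponds to that of `μ^* Λ_Z^{1,0}`, which
is the kernel of the surjection `Λ_𝕏^{1,0} → Λ_μ^{1,0}`; passing to quotients gives the
isomorphism of `Λ_μ^{1,0}` with the middle cohomology (`IsComplexification.exists_equiv`).

As for smoothness, pull-back of forms by the smooth map `ι` preserves it, and so does its inverse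
(`isSmoothAlong_of_pullback`): because `TX` spans `T` over `ℂ`, the extension of a form from `TX`
to `T` is computed by inverting a linear map that depends smoothly on the point.
-/

namespace DoubleFibration

open Filter Topology

/-! ### Local form of submersions and immersions -/

section LocalForms
variable {𝕜 E F : Type*} [NontriviallyNormedField 𝕜]
  [NormedAddCommGroup E] [NormedSpace 𝕜 E] [NormedAddCommGroup F] [NormedSpace 𝕜 F]
  {M N : Type*} [TopologicalSpace M] [ChartedSpace E M] [TopologicalSpace N] [ChartedSpace F N]
  {n : WithTop ℕ∞} {f : M → N} {x : M}

/-- A submersion `f` has a section near `f x` through `x`: it is `u ↦ (u, v(x))` in charts where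
`f` is the projection `(u, v) ↦ u`. -/
lemma _root_.Manifold.IsSubmersionAt.exists_localSection
    (h : Manifold.IsSubmersionAt 𝓘(𝕜, E) 𝓘(𝕜, F) n f x) (hn : 1 ≤ n) :
    ∃ σ : N → M, MDifferentiableAt 𝓘(𝕜, F) 𝓘(𝕜, E) σ (f x) ∧ σ (f x) = x ∧
      ∀ᶠ y in 𝓝 (f x), f (σ y) = y := by
  set φ := h.domChart
  set ψ := h.codChart
  set e := h.equiv
  have hx := h.mem_domChart_source
  have hfx := h.mem_codChart_source
  have hφ := IsManifold.maximalAtlas_subset_of_le hn h.domChart_mem_maximalAtlas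
  have hψ := IsManifold.maximalAtlas_subset_of_le hn h.codChart_mem_maximalAtlas
  have hw : ∀ u ∈ φ.target, ψ (f (φ.symm u)) = (e u).1 := fun u hu => by
    simpa using h.writtenInCharts (show u ∈ (φ.extend 𝓘(𝕜, E)).target by
      rw [OpenPartialHomeomorph.extend_target]; simpa using hu)
  have hpt : e.symm (ψ (f x), (e (φ x)).2) = φ x := by
    have := hw (φ x) (φ.map_source hx)
    rw [φ.left_inv hx] at this
    rw [this, Prod.mk.eta, e.symm_apply_apply]
  have hd : MDifferentiableAt 𝓘(𝕜, F) 𝓘(𝕜, E) (fun y => e.symm (ψ y, (e (φ x)).2)) (f x) := by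
    have h1 : DifferentiableAt 𝕜 (fun v : F => e.symm (v, (e (φ x)).2)) (ψ (f x)) := by fun_prop
    exact h1.mdifferentiableAt.comp (f x) (mdifferentiableAt_of_mem_maximalAtlas hψ hfx)
  have hc : ∀ᶠ y in 𝓝 (f x), e.symm (ψ y, (e (φ x)).2) ∈ φ.target := by
    refine hd.continuousAt.eventually_mem ?_
    rw [hpt]
    exact φ.open_target.mem_nhds (φ.map_source hx)
  refine ⟨fun y => φ.symm (e.symm (ψ y, (e (φ x)).2)), ?_, ?_, ?_⟩
  · refine MDifferentiableAt.comp (I' := 𝓘(𝕜, E)) (f x) (g := φ.symm) ?_ hd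
    rw [hpt]
    exact mdifferentiableAt_symm_of_mem_maximalAtlas hφ (φ.map_source hx)
  · simp only [hpt]
    exact φ.left_inv hx
  · filter_upwards [hc, ψ.open_source.mem_nhds hfx] with y hy hy'
    have h2 := h.source_subset_preimage_source (φ.map_target hy)
    exact ψ.injOn h2 hy' (by rw [hw _ hy, e.apply_symm_apply])

lemma _root_.Manifold.IsSubmersionAt.mfderiv_surjective
    (h : Manifold.IsSubmersionAt 𝓘(𝕜, E) 𝓘(𝕜, F) n f x) (hn : 1 ≤ n)
    (hf : MDifferentiableAt 𝓘(𝕜, E) 𝓘(𝕜, F) f x) :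
    Function.Surjective (mfderiv 𝓘(𝕜, E) 𝓘(𝕜, F) f x) := by
  obtain ⟨σ, hσ, hσx, hev⟩ := h.exists_localSection hn
  intro w
  rw [← hσx] at hf
  have h1 := (hf.hasMFDerivAt.comp (f x) hσ.hasMFDerivAt).congr_of_eventuallyEq
    (f₁ := id) (hev.mono fun y hy => hy.symm)
  have h2 := hasMFDerivAt_unique h1 (hasMFDerivAt_id (f x))
  have h3 := congrArg (fun L => L w) h2
  rw [hσx] at h3
  exact ⟨_, h3⟩

/-- A submersion `f` has, near `x`, a retraction `κ` onto the fibre through `x`: it is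
`(u, v) ↦ (u(x), v)` in charts where `f` is the projection `(u, v) ↦ u`. -/
lemma _root_.Manifold.IsSubmersionAt.exists_fibreRetraction
    (h : Manifold.IsSubmersionAt 𝓘(𝕜, E) 𝓘(𝕜, F) n f x) (hn : 1 ≤ n)
    (hf : MDifferentiableAt 𝓘(𝕜, E) 𝓘(𝕜, F) f x) :
    ∃ κ : M → M, κ x = x ∧ MDifferentiableAt 𝓘(𝕜, E) 𝓘(𝕜, E) κ x ∧
      (∀ᶠ y in 𝓝 x, f (κ y) = f x) ∧
      ∀ w : E, (mfderiv 𝓘(𝕜, E) 𝓘(𝕜, F) f x : E → F) w = 0 →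
        (mfderiv 𝓘(𝕜, E) 𝓘(𝕜, E) κ x : E → E) w = w := by
  set φ := h.domChart
  set ψ := h.codChart
  set e := h.equiv
  have hx := h.mem_domChart_source
  have hfx := h.mem_codChart_source
  have hφ := IsManifold.maximalAtlas_subset_of_le hn h.domChart_mem_maximalAtlas
  have hψ := IsManifold.maximalAtlas_subset_of_le hn h.codChart_mem_maximalAtlas
  have hw : ∀ u ∈ φ.target, ψ (f (φ.symm u)) = (e u).1 := fun u hu => by
    simpa using h.writtenInCharts (show u ∈ (φ.extend 𝓘(𝕜, E)).target by
      rw [OpenPartialHomeomorph.extend_target]; simpa using hu)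
  have hw' : ∀ y ∈ φ.source, ψ (f y) = (e (φ y)).1 := fun y hy => by
    have := hw (φ y) (φ.map_source hy)
    rwa [φ.left_inv hy] at this
  -- The projection `A` onto the fibre through `φ x` in the chart.
  let L : E →L[𝕜] E := e.symm.toContinuousLinearMap.comp
    ((ContinuousLinearMap.inr 𝕜 F h.complement).comp
      ((ContinuousLinearMap.snd 𝕜 F h.complement).comp e.toContinuousLinearMap))
  let A : E → E := fun u => L u + e.symm ((e (φ x)).1, 0)
  have hA : ∀ u, A u = e.symm ((e (φ x)).1, (e u).2) := fun u => by
    change e.symm (0, (e u).2) + e.symm ((e (φ x)).1, 0) = _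
    rw [← map_add, Prod.mk_add_mk, zero_add, add_zero]
  have hAx : A (φ x) = φ x := by rw [hA, Prod.mk.eta, e.symm_apply_apply]
  have hdA : HasMFDerivAt 𝓘(𝕜, E) 𝓘(𝕜, E) A (φ x) L :=
    (L.hasFDerivAt.add_const _).hasMFDerivAt
  have hdφ := (mdifferentiableAt_of_mem_maximalAtlas hφ hx).hasMFDerivAt
  have hdψ := (mdifferentiableAt_of_mem_maximalAtlas hψ hfx).hasMFDerivAt
  have hdφs : HasMFDerivAt 𝓘(𝕜, E) 𝓘(𝕜, E) φ.symm (φ x) _ :=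
    (mdifferentiableAt_symm_of_mem_maximalAtlas hφ (φ.map_source hx)).hasMFDerivAt
  have hdAφ := hdA.comp x hdφ
  have hdκ : HasMFDerivAt 𝓘(𝕜, E) 𝓘(𝕜, E) (φ.symm ∘ (A ∘ φ)) x
      ((mfderiv 𝓘(𝕜, E) 𝓘(𝕜, E) φ.symm (φ x) : E →L[𝕜] E).comp
        (L.comp (mfderiv 𝓘(𝕜, E) 𝓘(𝕜, E) φ x : E →L[𝕜] E))) := by
    refine HasMFDerivAt.comp x ?_ hdAφ
    rw [Function.comp_apply, hAx]
    exact hdφs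
  refine ⟨φ.symm ∘ (A ∘ φ), ?_, hdκ.mdifferentiableAt, ?_, fun w hw0 => ?_⟩
  · simp only [Function.comp_apply, hAx]
    exact φ.left_inv hx
  · have hc : ∀ᶠ y in 𝓝 x, A (φ y) ∈ φ.target := by
      refine hdAφ.1.eventually_mem ?_
      rw [Function.comp_apply, hAx]
      exact φ.open_target.mem_nhds (φ.map_source hx)
    filter_upwards [hc] with y hy
    have h2 := h.source_subset_preimage_source (φ.map_target hy)
    refine ψ.injOn h2 hfx ?_
    rw [hw _ hy, hA, e.apply_symm_apply, hw' x hx]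
  · rw [hdκ.mfderiv]
    set D : E →L[𝕜] E := mfderiv 𝓘(𝕜, E) 𝓘(𝕜, E) φ x
    have hD : (e (D w)).1 = 0 := by
      have h1 := (hdψ.comp x hf.hasMFDerivAt).congr_of_eventuallyEq
        (f₁ := fun y => (e (φ y)).1)
        (by filter_upwards [φ.open_source.mem_nhds hx] with y hy using (hw' y hy).symm)
      have h2 := ((ContinuousLinearMap.fst 𝕜 F h.complement).comp
        e.toContinuousLinearMap).hasMFDerivAt.comp x hdφ
      have h3 := congrArg (fun L : E →L[𝕜] F => L w) (hasMFDerivAt_unique h2 h1)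
      refine h3.trans ?_
      exact (congrArg (mfderiv 𝓘(𝕜, F) 𝓘(𝕜, F) ψ (f x)) hw0).trans (map_zero _)
    have hL : L (D w) = D w := by
      change e.symm (0, (e (D w)).2) = _
      rw [← hD, Prod.mk.eta, e.symm_apply_apply]
    have h4 := hasMFDerivAt_unique
      ((hdφs.comp x hdφ).congr_of_eventuallyEq (f₁ := id)
        (by filter_upwards [φ.open_source.mem_nhds hx] with y hy using (φ.left_inv hy).symm))
      (hasMFDerivAt_id x)
    exact (congrArg (mfderiv 𝓘(𝕜, E) 𝓘(𝕜, E) φ.symm (φ x)) hL).trans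
      (congrArg (fun L : E →L[𝕜] E => L w) h4)

/-- An immersion `f` has a left inverse near `x`: it is `(u, v) ↦ u` in charts where `f` is the
inclusion `u ↦ (u, 0)`. -/
lemma _root_.Manifold.IsImmersionAt.exists_localLeftInverse
    (h : Manifold.IsImmersionAt 𝓘(𝕜, E) 𝓘(𝕜, F) n f x) (hn : 1 ≤ n) :
    ∃ g : N → M, MDifferentiableAt 𝓘(𝕜, F) 𝓘(𝕜, E) g (f x) ∧ ∀ᶠ y in 𝓝 x, g (f y) = y := by
  set φ := h.domChart
  set ψ := h.codChart
  set e := h.equiv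
  have hx := h.mem_domChart_source
  have hfx := h.mem_codChart_source
  have hφ := IsManifold.maximalAtlas_subset_of_le hn h.domChart_mem_maximalAtlas
  have hψ := IsManifold.maximalAtlas_subset_of_le hn h.codChart_mem_maximalAtlas
  have hw : ∀ y ∈ φ.source, (e.symm (ψ (f y))).1 = φ y := fun y hy => by
    have := h.writtenInCharts (show φ y ∈ (φ.extend 𝓘(𝕜, E)).target by
      rw [OpenPartialHomeomorph.extend_target]; simpa using φ.map_source hy)
    have h2 : ψ (f (φ.symm (φ y))) = e (φ y, 0) := by simpa using this
    rw [φ.left_inv hy] at h2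
    rw [h2, e.symm_apply_apply]
  have hd : MDifferentiableAt 𝓘(𝕜, F) 𝓘(𝕜, E) (fun y => (e.symm (ψ y)).1) (f x) := by
    have h1 : DifferentiableAt 𝕜 (fun v : F => (e.symm v).1) (ψ (f x)) := by fun_prop
    exact h1.mdifferentiableAt.comp (f x) (mdifferentiableAt_of_mem_maximalAtlas hψ hfx)
  refine ⟨fun y => φ.symm (e.symm (ψ y)).1, ?_, ?_⟩
  · refine MDifferentiableAt.comp (I' := 𝓘(𝕜, E)) (f x) (g := φ.symm) ?_ hd
    rw [hw x hx]
    exact mdifferentiableAt_symm_of_mem_maximalAtlas hφ (φ.map_source hx)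
  · filter_upwards [φ.open_source.mem_nhds hx] with y hy
    rw [hw y hy, φ.left_inv hy]

lemma _root_.Manifold.IsImmersionAt.mfderiv_injective
    (h : Manifold.IsImmersionAt 𝓘(𝕜, E) 𝓘(𝕜, F) n f x) (hn : 1 ≤ n)
    (hf : MDifferentiableAt 𝓘(𝕜, E) 𝓘(𝕜, F) f x) :
    Function.Injective (mfderiv 𝓘(𝕜, E) 𝓘(𝕜, F) f x) := by
  obtain ⟨g, hg, hev⟩ := h.exists_localLeftInverse hn
  have h1 := (hg.hasMFDerivAt.comp x hf.hasMFDerivAt).congr_of_eventuallyEq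
    (f₁ := id) (hev.mono fun y hy => hy.symm)
  have h2 := hasMFDerivAt_unique h1 (hasMFDerivAt_id x)
  intro v w hvw
  have hv := congrArg (fun L => L v) h2
  have hw := congrArg (fun L => L w) h2
  exact hv.symm.trans ((congrArg (mfderiv 𝓘(𝕜, F) 𝓘(𝕜, E) g (f x)) hvw).trans hw)

end LocalForms

/-- The real differential of `f` at `x`, as a linear map of the model vector spaces; the tangent
spaces are these model spaces by definition. -/
noncomputable abbrev realDeriv (E F : Type*) [NormedAddCommGroup E] [NormedSpace ℝ E]
    [NormedAddCommGroup F] [NormedSpace ℝ F] {M N : Type*}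
    [TopologicalSpace M] [ChartedSpace E M] [TopologicalSpace N] [ChartedSpace F N]
    (f : M → N) (x : M) : E →L[ℝ] F :=
  mfderiv 𝓘(ℝ, E) 𝓘(ℝ, F) f x

section RestrictScalars
variable {E F : Type*}
  [NormedAddCommGroup E] [NormedSpace ℂ E] [NormedAddCommGroup F] [NormedSpace ℂ F]
  {M N : Type*} [TopologicalSpace M] [ChartedSpace E M] [TopologicalSpace N] [ChartedSpace F N]
  {f : M → N} {x : M}

/-- The real differential of a holomorphic map is the complex differential. -/
lemma hasMFDerivAt_restrictScalars {f' : E →L[ℂ] F}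
    (h : HasMFDerivAt 𝓘(ℂ, E) 𝓘(ℂ, F) f x f') :
    HasMFDerivAt 𝓘(ℝ, E) 𝓘(ℝ, F) f x (f'.restrictScalars ℝ : E →L[ℝ] F) :=
  ⟨h.1, h.2.restrictScalars ℝ⟩

/-- The real differential of a holomorphic map is complex linear. -/
lemma realDeriv_I_smul (h : MDifferentiableAt 𝓘(ℂ, E) 𝓘(ℂ, F) f x) (v : E) :
    realDeriv E F f x (Complex.I • v) = Complex.I • realDeriv E F f x v := by
  have h1 : realDeriv E F f x =
      (show E →L[ℂ] F from mfderiv 𝓘(ℂ, E) 𝓘(ℂ, F) f x).restrictScalars ℝ :=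
    (hasMFDerivAt_restrictScalars h.hasMFDerivAt).mfderiv
  rw [h1]
  exact map_smul (show E →L[ℂ] F from mfderiv 𝓘(ℂ, E) 𝓘(ℂ, F) f x) Complex.I v

end RestrictScalars

/-! ### Tangent spaces of the complexification along `X` -/

section Tangential

variable {EZ EX EM EXX EMM : Type*}
  [NormedAddCommGroup EZ] [NormedSpace ℂ EZ]
  [NormedAddCommGroup EX] [NormedSpace ℝ EX]
  [NormedAddCommGroup EM] [NormedSpace ℝ EM]
  [NormedAddCommGroup EXX] [NormedSpace ℂ EXX]
  [NormedAddCommGroup EMM] [NormedSpace ℂ EMM]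
  {Z X M XX MM : Type*}
  [TopologicalSpace X] [ChartedSpace EX X]
  [TopologicalSpace M] [ChartedSpace EM M]
  [TopologicalSpace XX] [ChartedSpace EXX XX]
  [TopologicalSpace MM] [ChartedSpace EMM MM]
  {η : X → Z} {τ : X → M} {μ : XX → Z} {ν : XX → MM} {ι : X → XX} {j : M → MM}

namespace IsComplexification

lemma contMDiff (hC : IsComplexification EX EM EXX EMM η τ μ ν ι j) :
    ContMDiff 𝓘(ℝ, EX) 𝓘(ℝ, EXX) ∞ ι :=
  hC.embedding.isImmersion.contMDiff

lemma mdifferentiable (hC : IsComplexification EX EM EXX EMM η τ μ ν ι j) :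
    MDifferentiable 𝓘(ℝ, EX) 𝓘(ℝ, EXX) ι :=
  hC.contMDiff.mdifferentiable (by simp)

lemma realDeriv_injective (hC : IsComplexification EX EM EXX EMM η τ μ ν ι j) (x : X) :
    Function.Injective (mfderiv 𝓘(ℝ, EX) 𝓘(ℝ, EXX) ι x) :=
  (hC.embedding.isImmersion.isImmersionAt x).mfderiv_injective (by simp) (hC.mdifferentiable x)

end IsComplexification

variable [TopologicalSpace Z] [ChartedSpace EZ Z]

namespace IsHolomorphicDoubleFibration

lemma mdifferentiable_left (hH : IsHolomorphicDoubleFibration EZ EXX EMM μ ν) :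
    MDifferentiable 𝓘(ℂ, EXX) 𝓘(ℂ, EZ) μ :=
  hH.submersion_left.contMDiff.mdifferentiable (by simp)

lemma mdifferentiable_right (hH : IsHolomorphicDoubleFibration EZ EXX EMM μ ν) :
    MDifferentiable 𝓘(ℂ, EXX) 𝓘(ℂ, EMM) ν :=
  hH.submersion_right.contMDiff.mdifferentiable (by simp)

lemma realDeriv_left_surjective (hH : IsHolomorphicDoubleFibration EZ EXX EMM μ ν) (p : XX) :
    Function.Surjective (mfderiv 𝓘(ℝ, EXX) 𝓘(ℝ, EZ) μ p) := by
  have hd := hH.mdifferentiable_left p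
  rw [(hasMFDerivAt_restrictScalars hd.hasMFDerivAt).mfderiv]
  exact (hH.submersion_left.isSubmersionAt p).mfderiv_surjective le_top hd

end IsHolomorphicDoubleFibration

namespace IsComplexification

lemma realDeriv_left (hC : IsComplexification EX EM EXX EMM η τ μ ν ι j)
    (hH : IsHolomorphicDoubleFibration EZ EXX EMM μ ν) (x : X) (v : EX) :
    realDeriv EX EZ η x v = realDeriv EXX EZ μ (ι x) (realDeriv EX EXX ι x v) := by
  have hη : η = μ ∘ ι := funext fun x => (hC.comm_left x).symm
  have hμ := hasMFDerivAt_restrictScalars (hH.mdifferentiable_left (ι x)).hasMFDerivAt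
  subst hη
  exact congrArg (fun L : EX →L[ℝ] EZ => L v)
    (mfderiv_comp x hμ.mdifferentiableAt (hC.mdifferentiable x))

lemma realDeriv_right (hC : IsComplexification EX EM EXX EMM η τ μ ν ι j)
    (hH : IsHolomorphicDoubleFibration EZ EXX EMM μ ν)
    (h : IsSmoothDoubleFibration EZ EX EM η τ) (x : X) (v : EX) :
    realDeriv EXX EMM ν (ι x) (realDeriv EX EXX ι x v) =
      realDeriv EM EMM j (τ x) (realDeriv EX EM τ x v) := by
  have hν := hasMFDerivAt_restrictScalars (hH.mdifferentiable_right (ι x)).hasMFDerivAt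
  have hτ : MDifferentiableAt 𝓘(ℝ, EX) 𝓘(ℝ, EM) τ x :=
    h.submersion_right.contMDiff.mdifferentiable (by simp) x
  have hj : MDifferentiableAt 𝓘(ℝ, EM) 𝓘(ℝ, EMM) j (τ x) :=
    hC.totallyReal.embedding.isImmersion.contMDiff.mdifferentiable (by simp) (τ x)
  have h1 := hν.mdifferentiableAt.hasMFDerivAt.comp x (hC.mdifferentiable x).hasMFDerivAt
  have h2 := (hj.hasMFDerivAt.comp x hτ.hasMFDerivAt).congr_of_eventuallyEq
    (f₁ := ν ∘ ι) (Eventually.of_forall hC.comm_right)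
  exact congrArg (fun L : EX →L[ℝ] EMM => L v) (hasMFDerivAt_unique h1 h2)

/-- A vector along `X` is tangent to a fibre of `ν` precisely when it comes from a vector tangent
to a fibre of `τ`, because `j` is immersive. -/
lemma mem_vert_iff (hC : IsComplexification EX EM EXX EMM η τ μ ν ι j)
    (hH : IsHolomorphicDoubleFibration EZ EXX EMM μ ν)
    (h : IsSmoothDoubleFibration EZ EX EM η τ) (x : X) (v : EX) :
    v ∈ Vert EX EM τ x ↔ realDeriv EXX EMM ν (ι x) (realDeriv EX EXX ι x v) = 0 := by
  have hji := hC.totallyReal.embedding.isImmersion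
  have hj : Function.Injective (mfderiv 𝓘(ℝ, EM) 𝓘(ℝ, EMM) j (τ x)) :=
    (hji.isImmersionAt (τ x)).mfderiv_injective (by simp)
      (hji.contMDiff.mdifferentiable (by simp) (τ x))
  rw [hC.realDeriv_right hH h x v]
  exact (map_eq_zero_iff _ hj).symm

/-- The tangent spaces of the fibres of `ν` over `M` are the images of those of the fibres of `τ`.
The retraction `κ` onto the fibre of `ν` takes values in `ι '' τ ⁻¹' {τ x}`, so it factors as
`ι ∘ g ∘ κ` with `g` a local left inverse of `ι`; its differential fixes the vertical vectors. -/
lemma exists_vert_of_realDeriv_right_eq_zero (hC : IsComplexification EX EM EXX EMM η τ μ ν ι j)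
    (hH : IsHolomorphicDoubleFibration EZ EXX EMM μ ν)
    (h : IsSmoothDoubleFibration EZ EX EM η τ) (x : X) (w : EXX)
    (hw : realDeriv EXX EMM ν (ι x) w = 0) :
    ∃ v : EX, v ∈ Vert EX EM τ x ∧ realDeriv EX EXX ι x v = w := by
  have hνd := hH.mdifferentiable_right (ι x)
  have hνR := hasMFDerivAt_restrictScalars hνd.hasMFDerivAt
  obtain ⟨κ, hκx, hκd, hκν, hκw⟩ :=
    (hH.submersion_right.isSubmersionAt (ι x)).exists_fibreRetraction le_top hνd
  obtain ⟨g, hg, hgι⟩ :=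
    (hC.embedding.isImmersion.isImmersionAt x).exists_localLeftInverse (by simp)
  have hκR := hasMFDerivAt_restrictScalars hκd.hasMFDerivAt
  have hgκ : ∀ᶠ q in 𝓝 (ι x), ι (g (κ q)) = κ q := by
    rw [hC.embedding.isEmbedding.nhds_eq_comap, eventually_comap] at hgι
    have h1 := hκd.continuousAt
    rw [ContinuousAt, hκx] at h1
    filter_upwards [h1.eventually hgι, hκν] with q hq hq'
    have h2 : κ q ∈ ι '' (τ ⁻¹' {τ x}) := by
      rw [hC.fibres]
      exact hq'.trans (hC.comm_right x)
    obtain ⟨y, -, hy⟩ := h2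
    rw [← hy, hq y hy]
  have hgx : g (ι x) = x := hgι.self_of_nhds
  rw [← hκx] at hg
  have h3 := hg.hasMFDerivAt.comp (ι x) hκR
  have h4 : HasMFDerivAt 𝓘(ℝ, EX) 𝓘(ℝ, EXX) ι ((g ∘ κ) (ι x))
      (mfderiv 𝓘(ℝ, EX) 𝓘(ℝ, EXX) ι x : EX →L[ℝ] EXX) := by
    rw [Function.comp_apply, hκx, hgx]
    exact (hC.mdifferentiable x).hasMFDerivAt
  have h5 := hasMFDerivAt_unique
    ((h4.comp (ι x) h3).congr_of_eventuallyEq (f₁ := κ) (hgκ.mono fun q hq => hq.symm)) hκR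
  have hw' := hw
  rw [realDeriv, hνR.mfderiv] at hw'
  have h6 := congrArg (fun L : EXX →L[ℝ] EXX => L w) h5
  have h7 := h6.trans (hκw w hw')
  exact ⟨_, (hC.mem_vert_iff hH h x _).2
    ((congrArg (realDeriv EXX EMM ν (ι x)) h7).trans hw), h7⟩

/-- `T𝕏` is spanned over `ℂ` by `TX` along `X`. -/
lemma exists_eq_add_smul (hC : IsComplexification EX EM EXX EMM η τ μ ν ι j)
    (hH : IsHolomorphicDoubleFibration EZ EXX EMM μ ν)
    (h : IsSmoothDoubleFibration EZ EX EM η τ) (x : X) (w : EXX) :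
    ∃ a b : EX, realDeriv EX EXX ι x a +
      Complex.I • realDeriv EX EXX ι x b = w := by
  have hτ : Function.Surjective (realDeriv EX EM τ x) :=
    (h.submersion_right.isSubmersionAt x).mfderiv_surjective (by simp)
      (h.submersion_right.contMDiff.mdifferentiable (by simp) x)
  have hcod := (hC.totallyReal.isCompl (τ x)).codisjoint.eq_top
  have hmem : realDeriv EXX EMM ν (ι x) w ∈ (⊤ : Submodule ℝ EMM) := Submodule.mem_top
  obtain ⟨_, ⟨m₁, rfl⟩, _, ⟨_, ⟨m₂, rfl⟩, rfl⟩, hsum⟩ :=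
    Submodule.mem_sup.1 ((SetLike.ext_iff.1 hcod _).2 hmem)
  obtain ⟨a, rfl⟩ := hτ m₁
  obtain ⟨b, rfl⟩ := hτ m₂
  replace hsum : realDeriv EM EMM j (τ x) (realDeriv EX EM τ x a) +
    Complex.I • realDeriv EM EMM j (τ x) (realDeriv EX EM τ x b) = realDeriv EXX EMM ν (ι x) w := hsum
  rw [← hC.realDeriv_right hH h, ← hC.realDeriv_right hH h,
    ← realDeriv_I_smul (hH.mdifferentiable_right (ι x)), ← map_add] at hsum
  obtain ⟨v, -, hv⟩ := hC.exists_vert_of_realDeriv_right_eq_zero hH h x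
    (w - (realDeriv EX EXX ι x a + Complex.I • realDeriv EX EXX ι x b)) (by rw [map_sub, hsum, sub_self])
  refine ⟨v + a, b, ?_⟩
  rw [map_add, hv]
  abel

/-- `TX` and `i TX` meet along `X` in vectors tangent to the fibres. -/
lemma mem_vert_of_add_smul_eq_zero (hC : IsComplexification EX EM EXX EMM η τ μ ν ι j)
    (hH : IsHolomorphicDoubleFibration EZ EXX EMM μ ν)
    (h : IsSmoothDoubleFibration EZ EX EM η τ) (x : X) (a b : EX)
    (hab : realDeriv EX EXX ι x a +
      Complex.I • realDeriv EX EXX ι x b = 0) :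
    b ∈ Vert EX EM τ x := by
  have h1 := congrArg (realDeriv EXX EMM ν (ι x)) hab
  rw [map_add, realDeriv_I_smul (hH.mdifferentiable_right (ι x)), hC.realDeriv_right hH h,
    hC.realDeriv_right hH h, map_zero] at h1
  have h2 : realDeriv EM EMM j (τ x) (realDeriv EX EM τ x a) = (0 : EMM) :=
    Submodule.disjoint_def.1 (hC.totallyReal.isCompl (τ x)).disjoint
    (realDeriv EM EMM j (τ x) (realDeriv EX EM τ x a)) ⟨_, rfl⟩
    ⟨realDeriv EM EMM j (τ x) (realDeriv EX EM τ x (-b)), ⟨_, rfl⟩, by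
      change Complex.I • realDeriv EM EMM j (τ x) (realDeriv EX EM τ x (-b)) = _
      rw [map_neg, map_neg, smul_neg]
      exact (eq_neg_of_add_eq_zero_left h1).symm⟩
  rw [h2, zero_add, smul_eq_zero_iff_right Complex.I_ne_zero] at h1
  rw [hC.mem_vert_iff hH h, hC.realDeriv_right hH h]
  exact h1

/-- The complex structure of the fibres of `τ` acquired from `Z` is the one that they have as
fibres of `ν`. -/
lemma realDeriv_fibreJ (hC : IsComplexification EX EM EXX EMM η τ μ ν ι j)
    (hH : IsHolomorphicDoubleFibration EZ EXX EMM μ ν)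
    (h : IsSmoothDoubleFibration EZ EX EM η τ) (x : X) (v : EX)
    (hv : v ∈ Vert EX EM τ x) :
    realDeriv EX EXX ι x (h.fibreJ x ⟨v, hv⟩).1 =
      Complex.I • realDeriv EX EXX ι x v := by
  have hv' := (hC.mem_vert_iff hH h x v).1 hv
  obtain ⟨w, hw, hwv⟩ := hC.exists_vert_of_realDeriv_right_eq_zero hH h x
    (Complex.I • realDeriv EX EXX ι x v)
    (by rw [realDeriv_I_smul (hH.mdifferentiable_right (ι x)), hv', smul_zero])
  have h1 : h.fibreJ x ⟨v, hv⟩ = ⟨w, hw⟩ := by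
    apply h.dEta_injective x
    rw [h.dEta_fibreJ]
    change Complex.I • realDeriv EX EZ η x v = realDeriv EX EZ η x w
    rw [hC.realDeriv_left hH, hC.realDeriv_left hH, hwv,
      realDeriv_I_smul (hH.mdifferentiable_left (ι x))]
  rw [h1]
  exact hwv

end IsComplexification
end Tangential

/-! ### The isomorphism at a point -/

section LinearAlgebra

/-- Two surjections with the same kernel have canonically isomorphic targets. -/
lemma exists_linearEquiv_of_ker_eq {R A B C : Type*} [Ring R] [AddCommGroup A] [Module R A]
    [AddCommGroup B] [Module R B] [AddCommGroup C] [Module R C]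
    (f : A →ₗ[R] B) (g : A →ₗ[R] C) (hf : Function.Surjective f) (hg : Function.Surjective g)
    (hfg : LinearMap.ker f = LinearMap.ker g) :
    ∃ e : B ≃ₗ[R] C, ∀ a, e (f a) = g a := by
  refine ⟨(f.quotKerEquivOfSurjective hf).symm ≪≫ₗ Submodule.quotEquivOfEq _ _ hfg ≪≫ₗ
    g.quotKerEquivOfSurjective hg, fun a => ?_⟩
  have h1 : (f.quotKerEquivOfSurjective hf).symm (f a) = Submodule.Quotient.mk a := by
    rw [LinearEquiv.symm_apply_eq]
    rfl
  simp only [LinearEquiv.trans_apply, h1]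
  rfl

variable {T W : Type*} [AddCommGroup T] [Module ℝ T]
  [NormedAddCommGroup W] [NormedSpace ℂ W]

/-- A real linear form `α` on `T` extends along `A : T → W` to a complex linear form on `W` as soon
as `A T` spans `W` over `ℂ` and `α` respects the complex linear relations on `A T`: the extension
is `A a + i A b ↦ α a + i α b`. -/
lemma exists_complexLinear_extension [FiniteDimensional ℂ W] (A : T →ₗ[ℝ] W) (α : T →ₗ[ℝ] ℂ)
    (hspan : ∀ w, ∃ a b, A a + Complex.I • A b = w)
    (hrel : ∀ a b, A a + Complex.I • A b = 0 → α a + Complex.I * α b = 0) :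
    ∃ ξ : W →L[ℝ] ℂ, (∀ w, ξ (Complex.I • w) = Complex.I * ξ w) ∧ ∀ v, ξ (A v) = α v := by
  let iW : W →ₗ[ℝ] W := (Complex.I • LinearMap.id : W →ₗ[ℂ] W).restrictScalars ℝ
  let P : T × T →ₗ[ℝ] W := A.coprod (iW.comp A)
  have hP : ∀ a b, P (a, b) = A a + Complex.I • A b := fun a b => rfl
  let G : T × T →ₗ[ℝ] ℂ := α.coprod
    (((Complex.I • LinearMap.id : ℂ →ₗ[ℂ] ℂ).restrictScalars ℝ).comp α)
  have hG : ∀ a b, G (a, b) = α a + Complex.I * α b := fun a b => rfl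
  have hsurj : Function.Surjective P := fun w => by
    obtain ⟨a, b, h⟩ := hspan w
    exact ⟨(a, b), h⟩
  obtain ⟨R, hR⟩ := P.exists_rightInverse_of_surjective (LinearMap.range_eq_top.2 hsurj)
  have hGR : ∀ u, G (R (P u)) = G u := fun u => by
    rw [← sub_eq_zero, ← map_sub]
    have h0 : P (R (P u) - u) = 0 := by
      rw [map_sub, sub_eq_zero]
      exact LinearMap.congr_fun hR (P u)
    exact hrel _ _ h0
  refine ⟨LinearMap.toContinuousLinearMap (G.comp R), fun w => ?_, fun v => ?_⟩
  · obtain ⟨⟨a, b⟩, rfl⟩ := hsurj w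
    have h1 : Complex.I • P (a, b) = P (-b, a) := by
      rw [hP, hP, smul_add, smul_smul, Complex.I_mul_I, map_neg, neg_one_smul, add_comm]
    change G (R (Complex.I • P (a, b))) = Complex.I * G (R (P (a, b)))
    rw [h1, hGR, hGR, hG, hG, map_neg]
    linear_combination (-α b) * Complex.I_mul_I
  · change G (R (A v)) = α v
    have h1 : A v = P (v, 0) := by simp [hP]
    rw [h1, hGR, hG]
    simp

end LinearAlgebra

section Pointwise

variable {EZ EX EM EXX EMM : Type*}
  [NormedAddCommGroup EZ] [NormedSpace ℂ EZ]
  [NormedAddCommGroup EX] [NormedSpace ℝ EX]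
  [NormedAddCommGroup EM] [NormedSpace ℝ EM]
  [NormedAddCommGroup EXX] [NormedSpace ℂ EXX]
  [NormedAddCommGroup EMM] [NormedSpace ℂ EMM]
  {Z X M XX MM : Type*}
  [TopologicalSpace Z] [ChartedSpace EZ Z]
  [TopologicalSpace X] [ChartedSpace EX X]
  [TopologicalSpace M] [ChartedSpace EM M]
  [TopologicalSpace XX] [ChartedSpace EXX XX]
  [TopologicalSpace MM] [ChartedSpace EMM MM]
  {η : X → Z} {τ : X → M} {μ : XX → Z} {ν : XX → MM} {ι : X → XX} {j : M → MM}

/-- A form on `X` is in the kernel of `Λ_X¹ → Λ_τ^{0,1}` when it is complex linear along the fibres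
of `τ`. -/
lemma IsSmoothDoubleFibration.complexSnd_eq_zero_iff [FiniteDimensional ℝ EX]
    (h : IsSmoothDoubleFibration EZ EX EM η τ) (x : X) (α : Form1 EX x) :
    h.complexSnd x α = 0 ↔ ∀ (v : EX) (hv : v ∈ Vert EX EM τ x),
      α (h.fibreJ x ⟨v, hv⟩).1 = Complex.I * α v := by
  have key : ∀ v : Vert EX EM τ x, (h.complexSnd x α).1 v =
      (1 / 2 : ℂ) * (α v.1 + Complex.I * α (h.fibreJ x v).1) := fun v => rfl
  constructor
  · intro h0 v hv
    have h1 := key ⟨v, hv⟩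
    rw [h0] at h1
    replace h1 : 0 = (1 / 2 : ℂ) * (α v + Complex.I * α (h.fibreJ x ⟨v, hv⟩).1) := h1
    linear_combination (2 * Complex.I) * h1 + α (h.fibreJ x ⟨v, hv⟩).1 * Complex.I_mul_I
  · intro h0
    apply Subtype.ext
    ext v
    refine (key v).trans ?_
    rw [h0 v.1 v.2]
    change (1 / 2 : ℂ) * (α v.1 + Complex.I * (Complex.I * α v.1)) = 0
    linear_combination (1 / 2 * α v.1) * Complex.I_mul_I

namespace IsComplexification

lemma complexSnd_pullback [FiniteDimensional ℝ EX]
    (hC : IsComplexification EX EM EXX EMM η τ μ ν ι j)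
    (hH : IsHolomorphicDoubleFibration EZ EXX EMM μ ν)
    (h : IsSmoothDoubleFibration EZ EX EM η τ) (x : X) (ξ : Form10 EXX (ι x)) :
    h.complexSnd x (pullback ι x ξ.1) = 0 := by
  rw [h.complexSnd_eq_zero_iff]
  intro v hv
  exact (congrArg ξ.1 (hC.realDeriv_fibreJ hH h x v hv)).trans (ξ.2 _)

/-- A `(1,0)`-form on `𝕏` is determined by its pull-back to `X`. -/
lemma pullback_injective (hC : IsComplexification EX EM EXX EMM η τ μ ν ι j)
    (hH : IsHolomorphicDoubleFibration EZ EXX EMM μ ν)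
    (h : IsSmoothDoubleFibration EZ EX EM η τ) (x : X) {ξ ζ : Form10 EXX (ι x)}
    (hξ : pullback (E := EX) ι x ξ.1 = pullback ι x ζ.1) : ξ = ζ := by
  apply Subtype.ext
  ext w
  have key : ∀ v : EX, ξ.1 (realDeriv EX EXX ι x v) = ζ.1 (realDeriv EX EXX ι x v) :=
    fun v => congrArg (fun L : Form1 EX x => L v) hξ
  obtain ⟨a, b, rfl⟩ := hC.exists_eq_add_smul hH h x w
  refine (map_add ξ.1 _ _).trans (Eq.trans ?_ (map_add ζ.1 _ _).symm)
  exact congrArg₂ (· + ·) (key a) ((ξ.2 _).trans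
    ((congrArg (Complex.I * ·) (key b)).trans (ζ.2 _).symm))

/-- Every form in the kernel of `Λ_X¹ → Λ_τ^{0,1}` is the pull-back of a `(1,0)`-form on `𝕏`. -/
lemma exists_pullback_eq [FiniteDimensional ℝ EX] [FiniteDimensional ℂ EXX]
    (hC : IsComplexification EX EM EXX EMM η τ μ ν ι j)
    (hH : IsHolomorphicDoubleFibration EZ EXX EMM μ ν)
    (h : IsSmoothDoubleFibration EZ EX EM η τ) (x : X) (α : Form1 EX x)
    (hα : h.complexSnd x α = 0) : ∃ ξ : Form10 EXX (ι x), pullback ι x ξ.1 = α := by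
  rw [h.complexSnd_eq_zero_iff] at hα
  obtain ⟨ξ, hξ, hξα⟩ := exists_complexLinear_extension
    (realDeriv EX EXX ι x).toLinearMap (show EX →L[ℝ] ℂ from α).toLinearMap
    (hC.exists_eq_add_smul hH h x) (fun a b hab => by
      replace hab : realDeriv EX EXX ι x a + Complex.I • realDeriv EX EXX ι x b = 0 := hab
      have hb := hC.mem_vert_of_add_smul_eq_zero hH h x a b hab
      let c : EX := (h.fibreJ x ⟨b, hb⟩).1
      have hac : a = -c := by
        apply hC.realDeriv_injective x
        change realDeriv EX EXX ι x a = realDeriv EX EXX ι x (-c)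
        rw [map_neg, hC.realDeriv_fibreJ hH h x b hb]
        exact eq_neg_of_add_eq_zero_left hab
      have hc : (show EX →L[ℝ] ℂ from α) c = Complex.I * (show EX →L[ℝ] ℂ from α) b := hα b hb
      change (show EX →L[ℝ] ℂ from α) a + Complex.I * (show EX →L[ℝ] ℂ from α) b = 0
      rw [hac, map_neg, hc, neg_add_cancel])
  exact ⟨⟨ξ, hξ⟩, ContinuousLinearMap.ext hξα⟩

end IsComplexification

/-- Every `(1,0)`-form along the fibres of `μ` extends to a `(1,0)`-form: take the part of type
`(1,0)` of a real linear extension. -/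
lemma restrict10_surjective [FiniteDimensional ℂ EXX] (μ : XX → Z) (p : XX)
    (hμ : ∀ v : EXX, realDeriv EXX EZ μ p (Complex.I • v) = Complex.I • realDeriv EXX EZ μ p v) :
    Function.Surjective (restrict10 (EZ := EZ) (EXX := EXX) μ p) := by
  intro β
  obtain ⟨g, hg⟩ := LinearMap.exists_extend
    (p := (show Submodule ℝ EXX from Vert EXX EZ μ p)) β.1.toLinearMap
  let iE : EXX →ₗ[ℝ] EXX := (Complex.I • LinearMap.id : EXX →ₗ[ℂ] EXX).restrictScalars ℝ
  let iC : ℂ →ₗ[ℝ] ℂ := (Complex.I • LinearMap.id : ℂ →ₗ[ℂ] ℂ).restrictScalars ℝ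
  let g' : EXX →ₗ[ℝ] ℂ := (1 / 2 : ℝ) • (g - iC.comp (g.comp iE))
  have hg' : ∀ v, g' v = (1 / 2 : ℂ) * (g v - Complex.I * g (Complex.I • v)) := fun v => by
    change (1 / 2 : ℝ) • (g v - Complex.I * g (Complex.I • v)) = _
    rw [Complex.real_smul]
    norm_num
  have hg'I : ∀ v : EXX, g' (Complex.I • v) = Complex.I * g' v := fun v => by
    rw [hg', hg', smul_smul, Complex.I_mul_I, neg_one_smul, map_neg]
    linear_combination (1 / 2 * g (Complex.I • v)) * Complex.I_mul_I
  have hg'β : ∀ (v : EXX) (hv : v ∈ Vert EXX EZ μ p), g' v = β.1 ⟨v, hv⟩ := fun v hv => by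
    have hv' : realDeriv EXX EZ μ p v = 0 := hv
    have hJ : realDeriv EXX EZ μ p (Complex.I • v) = 0 := by rw [hμ, hv', smul_zero]
    have h1 : g v = β.1 ⟨v, hv⟩ := LinearMap.congr_fun hg ⟨v, hv⟩
    have h2 : g (Complex.I • v) = β.1 ⟨Complex.I • v, hJ⟩ :=
      LinearMap.congr_fun hg ⟨Complex.I • v, hJ⟩
    rw [hg', h2, h1, β.2 ⟨v, hv⟩ ⟨Complex.I • v, hJ⟩ rfl]
    linear_combination (-(1 / 2) * β.1 ⟨v, hv⟩) * Complex.I_mul_I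
  exact ⟨⟨LinearMap.toContinuousLinearMap g', hg'I⟩,
    Subtype.ext (ContinuousLinearMap.ext fun v => hg'β v.1 v.2)⟩

/-- A `(1,0)`-form vanishing on the fibres of `μ` is the pull-back by `μ` of a `(1,0)`-form. -/
lemma exists_form10_of_restrict10_eq_zero [FiniteDimensional ℂ EZ] (μ : XX → Z) (p : XX)
    (hμ : ∀ v : EXX, realDeriv EXX EZ μ p (Complex.I • v) = Complex.I • realDeriv EXX EZ μ p v)
    (hs : Function.Surjective (realDeriv EXX EZ μ p)) (ξ : Form10 EXX p)
    (hξ : restrict10 (EZ := EZ) μ p ξ = 0) :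
    ∃ β : Form10 EZ (μ p), pullback μ p β.1 = ξ.1 := by
  let ξ' : EXX →L[ℝ] ℂ := ξ.1
  have hξ0 : ∀ v : EXX, realDeriv EXX EZ μ p v = 0 → ξ' v = 0 := fun v hv =>
    congrArg (fun L : VertForm10 EZ EXX μ p => L.1 ⟨v, hv⟩) hξ
  have hξ1 : ∀ v w : EXX, realDeriv EXX EZ μ p v = realDeriv EXX EZ μ p w → ξ' v = ξ' w :=
    fun v w hvw => by
      rw [← sub_eq_zero, ← map_sub]
      exact hξ0 _ (by rw [map_sub, hvw, sub_self])
  obtain ⟨σ, hσ⟩ := (realDeriv EXX EZ μ p).toLinearMap.exists_rightInverse_of_surjective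
    (LinearMap.range_eq_top.2 hs)
  have hσ' : ∀ z, realDeriv EXX EZ μ p (σ z) = z := fun z => LinearMap.congr_fun hσ z
  have hσI : ∀ z : EZ, ξ' (σ (Complex.I • z)) = Complex.I * ξ' (σ z) := fun z => by
    refine (hξ1 _ (Complex.I • σ z) ?_).trans (ξ.2 _)
    rw [hσ', hμ, hσ']
  exact ⟨⟨LinearMap.toContinuousLinearMap (ξ'.toLinearMap.comp σ), hσI⟩,
    ContinuousLinearMap.ext fun v => hξ1 _ _ (hσ' _)⟩

/-- At each point of `X`, pull-back by `ι` induces an isomorphism of `Λ_μ^{1,0}` with the middle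
cohomology. -/
lemma IsComplexification.exists_equiv [FiniteDimensional ℂ EZ] [FiniteDimensional ℝ EX]
    [FiniteDimensional ℂ EXX]
    (hC : IsComplexification EX EM EXX EMM η τ μ ν ι j)
    (hH : IsHolomorphicDoubleFibration EZ EXX EMM μ ν)
    (h : IsSmoothDoubleFibration EZ EX EM η τ) (x : X) :
    ∃ e : VertForm10 EZ EXX μ (ι x) ≃ₗ[ℂ] h.MiddleCohomology x, ∀ ξ : Form10 EXX (ι x),
      e (restrict10 μ (ι x) ξ) =
        h.middleClass x (pullback ι x ξ.1) (hC.complexSnd_pullback hH h x ξ) := by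
  let P : Form10 EXX (ι x) →ₗ[ℂ] LinearMap.ker (h.complexSnd x) :=
    ((pullback ι x).comp (Form10 EXX (ι x)).subtype).codRestrict _
      (hC.complexSnd_pullback hH h x)
  let Q : Form10 EXX (ι x) →ₗ[ℂ] h.MiddleCohomology x := (Submodule.mkQ _).comp P
  have hμ := fun v => realDeriv_I_smul (hH.mdifferentiable_left (ι x)) v
  have hηx : ∀ β : EZ →L[ℝ] ℂ, (∀ z, β (Complex.I • z) = Complex.I * β z) →
      ∃ γ : Form10 EZ (η x), γ.1 = β := fun β hβ => ⟨⟨β, hβ⟩, rfl⟩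
  have hcomp : ∀ (β : EZ →L[ℝ] ℂ) (v : EX), β (realDeriv EX EZ η x v) =
      β (realDeriv EXX EZ μ (ι x) (realDeriv EX EXX ι x v)) := fun β v => by
    rw [hC.realDeriv_left hH]
  refine exists_linearEquiv_of_ker_eq (R := ℂ) (A := Form10 EXX (ι x))
    (B := VertForm10 EZ EXX μ (ι x)) (C := h.MiddleCohomology x) (restrict10 μ (ι x)) Q
    (restrict10_surjective μ (ι x) hμ) ?_ ?_
  · refine (Submodule.mkQ_surjective _).comp fun α => ?_
    obtain ⟨ξ, hξ⟩ := hC.exists_pullback_eq hH h x α.1 α.2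
    exact ⟨ξ, Subtype.ext hξ⟩
  · ext ξ
    have hQ : Q ξ = 0 ↔ ∃ β : Form10 EZ (η x), h.complexFst x β = pullback ι x ξ.1 :=
      Submodule.Quotient.mk_eq_zero _
    rw [LinearMap.mem_ker, LinearMap.mem_ker, hQ]
    constructor
    · intro hξ
      obtain ⟨β, hβ⟩ := exists_form10_of_restrict10_eq_zero μ (ι x) hμ
        (hH.realDeriv_left_surjective (ι x)) ξ hξ
      refine ⟨⟨β.1, β.2⟩, ContinuousLinearMap.ext fun v => ?_⟩
      exact (hcomp β.1 v).trans
        (congrArg (fun L : EXX →L[ℝ] ℂ => L (realDeriv EX EXX ι x v)) hβ)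
    · rintro ⟨β, hβ⟩
      let ζ : Form10 EXX (ι x) :=
        ⟨(show EZ →L[ℝ] ℂ from β.1).comp (realDeriv EXX EZ μ (ι x)), fun v =>
          (congrArg (show EZ →L[ℝ] ℂ from β.1) (hμ v)).trans (β.2 _)⟩
      have hζ : ζ = ξ := hC.pullback_injective hH h x
        (hβ ▸ ContinuousLinearMap.ext fun v => (hcomp β.1 v).symm)
      rw [← hζ]
      apply Subtype.ext
      ext v
      exact (congrArg (show EZ →L[ℝ] ℂ from β.1) v.2).trans (map_zero _)

end Pointwise

/-! ### Smoothness -/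

section Coordinates

variable {E : Type*} [NormedAddCommGroup E] [NormedSpace ℝ E]
  {M : Type*} [TopologicalSpace M] [ChartedSpace E M]
  {E' : Type*} [NormedAddCommGroup E'] [NormedSpace ℝ E']
  {N : Type*} [TopologicalSpace N] [ChartedSpace E' N] [IsManifold 𝓘(ℝ, E') ∞ N]

/-- The frame of `TN` at `y` given by the chart at `y₀`: the inverse of the trivialization of the
tangent bundle. -/
noncomputable abbrev chartFrame (E' : Type*) [NormedAddCommGroup E'] [NormedSpace ℝ E']
    {N : Type*} [TopologicalSpace N] [ChartedSpace E' N] [IsManifold 𝓘(ℝ, E') ∞ N]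
    (y₀ y : N) : E' →L[ℝ] E' :=
  (trivializationAt E' (TangentSpace 𝓘(ℝ, E') : N → Type _) y₀).symmL ℝ y

/-- A family of 1-forms along `f` is smooth at `x₀` when its coefficients in a chart frame are. -/
lemma contMDiffAt_form_iff (f : M → N) (α : ∀ x : M, Form1 E' (f x)) (x₀ : M) :
    ContMDiffAt 𝓘(ℝ, E) (𝓘(ℝ, E').prod 𝓘(ℝ, E' →L[ℝ] ℂ)) ∞
      (fun x => TotalSpace.mk' (E' →L[ℝ] ℂ)
        (E := fun y : N => TangentSpace 𝓘(ℝ, E') y →L[ℝ] Trivial N ℂ y) (f x) (α x)) x₀ ↔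
    ContMDiffAt 𝓘(ℝ, E) 𝓘(ℝ, E') ∞ f x₀ ∧
      ContMDiffAt 𝓘(ℝ, E) 𝓘(ℝ, E' →L[ℝ] ℂ) ∞
        (fun x => (show E' →L[ℝ] ℂ from α x).comp (chartFrame E' (f x₀) (f x))) x₀ := by
  rw [contMDiffAt_hom_bundle]
  refine and_congr Iff.rfl (iff_of_eq (congrArg
    (fun g => ContMDiffAt 𝓘(ℝ, E) 𝓘(ℝ, E' →L[ℝ] ℂ) ∞ g x₀) (funext fun x => ?_)))
  exact congrArg (fun L : ℂ →L[ℝ] ℂ => L.comp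
    ((show E' →L[ℝ] ℂ from α x).comp (chartFrame E' (f x₀) (f x))))
    (Bundle.Trivial.continuousLinearMapAt_trivialization ℝ N ℂ (f x))

lemma isSmoothAlong_iff {f : M → N} (hf : ContMDiff 𝓘(ℝ, E) 𝓘(ℝ, E') ∞ f)
    {α : ∀ x : M, Form1 E' (f x)} {U : Set M} (hU : IsOpen U) :
    IsSmoothAlong (E := E) f α U ↔ ∀ x₀ ∈ U, ContMDiffAt 𝓘(ℝ, E) 𝓘(ℝ, E' →L[ℝ] ℂ) ∞
        (fun x => (show E' →L[ℝ] ℂ from α x).comp (chartFrame E' (f x₀) (f x))) x₀ := by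
  refine forall₂_congr fun x₀ hx₀ => ?_
  exact ⟨fun h => ((contMDiffAt_form_iff f α x₀).1 (h.contMDiffAt (hU.mem_nhds hx₀))).2,
    fun h => ((contMDiffAt_form_iff f α x₀).2 ⟨hf x₀, h⟩).contMDiffWithinAt⟩

end Coordinates

/-- The chart frames of a complex manifold are complex linear, because its charts are
holomorphic. -/
lemma chartFrame_I_smul {E : Type*} [NormedAddCommGroup E] [NormedSpace ℂ E]
    {M : Type*} [TopologicalSpace M] [ChartedSpace E M] [IsManifold 𝓘(ℂ, E) ω M] {y₀ y : M}
    (hy : y ∈ (chartAt E y₀).source) (v : E) :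
    chartFrame E y₀ y (Complex.I • v) = Complex.I • chartFrame E y₀ y v := by
  let e := trivializationAt E (TangentSpace 𝓘(ℝ, E) : M → Type _) y₀
  let C : E →L[ℝ] E := e.continuousLinearMapAt ℝ y
  have hC : C = realDeriv E E (extChartAt 𝓘(ℝ, E) y₀) y :=
    TangentBundle.continuousLinearMapAt_trivializationAt hy
  have hd : MDifferentiableAt 𝓘(ℂ, E) 𝓘(ℂ, E) (extChartAt 𝓘(ℝ, E) y₀) y :=
    mdifferentiableAt_extChartAt (I := 𝓘(ℂ, E)) hy
  have h1 : ∀ w, C (Complex.I • w) = Complex.I • C w := fun w => by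
    rw [hC, realDeriv_I_smul hd]
  have h2 : ∀ w, C (chartFrame E y₀ y w) = w := e.continuousLinearMapAt_symmL hy
  have h3 : ∀ w, chartFrame E y₀ y (C w) = w := e.symmL_continuousLinearMapAt hy
  rw [← h3 (Complex.I • chartFrame E y₀ y v), h1, h2]

section Frames
variable {E : Type*} [NormedAddCommGroup E] [NormedSpace ℝ E]
  {M : Type*} [TopologicalSpace M] [ChartedSpace E M] [IsManifold 𝓘(ℝ, E) ∞ M]
  {E' : Type*} [NormedAddCommGroup E'] [NormedSpace ℝ E']
  {N : Type*} [TopologicalSpace N] [ChartedSpace E' N] [IsManifold 𝓘(ℝ, E') ∞ N]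

/-- The coefficients in chart frames of the differential of a smooth map are smooth. -/
lemma exists_coordinates_realDeriv {f : M → N} (hf : ContMDiff 𝓘(ℝ, E) 𝓘(ℝ, E') ∞ f) (x₀ : M) :
    ∃ A : M → E →L[ℝ] E', ContMDiffAt 𝓘(ℝ, E) 𝓘(ℝ, E →L[ℝ] E') ∞ A x₀ ∧
      ∀ᶠ x in 𝓝 x₀, ∀ v, chartFrame E' (f x₀) (f x) (A x v) =
        realDeriv E E' f x (chartFrame E x₀ x v) := by
  refine ⟨_, (hf x₀).mfderiv_const (m := ∞) (by simp), ?_⟩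
  have h1 : ∀ᶠ x in 𝓝 x₀, f x ∈ (chartAt E' (f x₀)).source :=
    hf.continuous.continuousAt.eventually_mem (chart_source_mem_nhds E' (f x₀))
  filter_upwards [h1] with x hx v
  exact Trivialization.symmL_continuousLinearMapAt _ hx _

lemma IsSmoothAlong.pullback {f : M → N} (hf : ContMDiff 𝓘(ℝ, E) 𝓘(ℝ, E') ∞ f)
    {ξ : ∀ x : M, Form1 E' (f x)} {U : Set M} (hU : IsOpen U)
    (hξ : IsSmoothAlong (E := E) f ξ U) :
    IsSmoothAlong (E := E) (E' := E) (id : M → M) (fun x => pullback f x (ξ x)) U := by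
  rw [isSmoothAlong_iff hf hU] at hξ
  refine (isSmoothAlong_iff (f := (id : M → M)) contMDiff_id hU).2 fun x₀ hx₀ => ?_
  obtain ⟨A, hA, hAf⟩ := exists_coordinates_realDeriv hf x₀
  refine ((hξ x₀ hx₀).clm_comp hA).congr_of_eventuallyEq ?_
  filter_upwards [hAf] with x hx
  ext v
  exact (congrArg (show E' →L[ℝ] ℂ from ξ x) (hx v)).symm

end Frames

section ComplexFrames
variable {E : Type*} [NormedAddCommGroup E] [NormedSpace ℝ E]
  {M : Type*} [TopologicalSpace M] [ChartedSpace E M] [IsManifold 𝓘(ℝ, E) ∞ M]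
  {E' : Type*} [NormedAddCommGroup E'] [NormedSpace ℂ E'] [FiniteDimensional ℂ E']
  {N : Type*} [TopologicalSpace N] [ChartedSpace E' N] [IsManifold 𝓘(ℂ, E') ω N]

/-- If the image of the differential of `f` spans `TN` over `ℂ`, then a family of `(1,0)`-forms
along `f` is smooth when its pull-back is.

With `A x` the differential in chart frames, there are constant `R₁` and `R₂` such that
`S x = A x ∘ R₁ + i A x ∘ R₂` is the identity at `x₀`, hence is invertible near `x₀`. In chart
frames the pull-back `α = ξ ∘ A` satisfies `ξ ∘ S = α ∘ R₁ + i α ∘ R₂`, so that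
`ξ = (α ∘ R₁ + i α ∘ R₂) ∘ S⁻¹`. -/
lemma isSmoothAlong_of_pullback {f : M → N} (hf : ContMDiff 𝓘(ℝ, E) 𝓘(ℝ, E') ∞ f)
    (hspan : ∀ (x : M) (w : E'), ∃ a b : E,
      realDeriv E E' f x a + Complex.I • realDeriv E E' f x b = w)
    {ξ : ∀ x : M, Form10 E' (f x)} {U : Set M} (hU : IsOpen U)
    (hξ : IsSmoothAlong (E := E) (E' := E) (id : M → M)
      (fun x => DoubleFibration.pullback f x (ξ x).1) U) :
    IsSmoothAlong (E := E) f (fun x => (ξ x).1) U := by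
  have : CompleteSpace E' := FiniteDimensional.complete ℂ E'
  rw [isSmoothAlong_iff (f := (id : M → M)) contMDiff_id hU] at hξ
  refine (isSmoothAlong_iff hf hU).2 fun x₀ hx₀ => ?_
  replace hξ := hξ x₀ hx₀
  obtain ⟨A, hA, hAf⟩ := exists_coordinates_realDeriv hf x₀
  have hchart : ∀ᶠ x in 𝓝 x₀, f x ∈ (chartAt E' (f x₀)).source :=
    hf.continuous.continuousAt.eventually_mem (chart_source_mem_nhds E' (f x₀))
  let e := trivializationAt E (TangentSpace 𝓘(ℝ, E) : M → Type _) x₀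
  let e' := trivializationAt E' (TangentSpace 𝓘(ℝ, E') : N → Type _) (f x₀)
  let iE : E' →L[ℝ] E' := (Complex.I • ContinuousLinearMap.id ℂ E').restrictScalars ℝ
  let iC : ℂ →L[ℝ] ℂ := (Complex.I • ContinuousLinearMap.id ℂ ℂ).restrictScalars ℝ
  have hA₀ : ∀ w : E', ∃ a b : E, A x₀ a + Complex.I • A x₀ b = w := fun w => by
    obtain ⟨a, b, hab⟩ := hspan x₀ (chartFrame E' (f x₀) (f x₀) w)
    have ha : ∀ a : E, chartFrame E x₀ x₀ (e.continuousLinearMapAt ℝ x₀ a) = a :=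
      e.symmL_continuousLinearMapAt (mem_chart_source E x₀)
    have hinj : Function.Injective (chartFrame E' (f x₀) (f x₀)) :=
      Function.LeftInverse.injective
        (g := (show E' →L[ℝ] E' from e'.continuousLinearMapAt ℝ (f x₀)))
        (e'.continuousLinearMapAt_symmL hchart.self_of_nhds)
    refine ⟨e.continuousLinearMapAt ℝ x₀ a, e.continuousLinearMapAt ℝ x₀ b, hinj ?_⟩
    rw [map_add, chartFrame_I_smul hchart.self_of_nhds, hAf.self_of_nhds, hAf.self_of_nhds,
      ha, ha, hab]
  let P : E × E →ₗ[ℝ] E' := (A x₀).toLinearMap.coprod (iE.comp (A x₀)).toLinearMap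
  obtain ⟨R, hR⟩ := P.exists_rightInverse_of_surjective (LinearMap.range_eq_top.2 fun w => by
    obtain ⟨a, b, hab⟩ := hA₀ w
    exact ⟨(a, b), hab⟩)
  let R₁ : E' →L[ℝ] E := LinearMap.toContinuousLinearMap ((LinearMap.fst ℝ E E).comp R)
  let R₂ : E' →L[ℝ] E := LinearMap.toContinuousLinearMap ((LinearMap.snd ℝ E E).comp R)
  let S : M → E' →L[ℝ] E' := fun x => (A x).comp R₁ + iE.comp ((A x).comp R₂)
  have hS : ContMDiffAt 𝓘(ℝ, E) 𝓘(ℝ, E' →L[ℝ] E') ∞ S x₀ :=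
    (hA.clm_comp contMDiffAt_const).add
      (contMDiffAt_const.clm_comp (hA.clm_comp contMDiffAt_const))
  have hS₀ : S x₀ = ContinuousLinearMap.id ℝ E' := by
    ext w
    exact LinearMap.congr_fun hR w
  have hSinv : ∀ᶠ x in 𝓝 x₀, (S x).IsInvertible := by
    have h1 : {L : E' →L[ℝ] E' | L.IsInvertible} ∈ 𝓝 (S x₀) := by
      rw [hS₀]
      exact (ContinuousLinearEquiv.refl ℝ E').nhds
    exact hS.continuousAt h1
  have hSi : ContMDiffAt 𝓘(ℝ, E) 𝓘(ℝ, E' →L[ℝ] E') ∞ (fun x => (S x).inverse) x₀ :=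
    (hSinv.self_of_nhds.contDiffAt_map_inverse.contMDiffAt).comp x₀ hS
  let a : M → E →L[ℝ] ℂ := fun x => (show E →L[ℝ] ℂ from
    DoubleFibration.pullback f x (ξ x).1).comp (chartFrame E x₀ x)
  have hnum : ContMDiffAt 𝓘(ℝ, E) 𝓘(ℝ, E' →L[ℝ] ℂ) ∞
      (fun x => (a x).comp R₁ + iC.comp ((a x).comp R₂)) x₀ :=
    (ContMDiffAt.clm_comp hξ contMDiffAt_const).add
      (contMDiffAt_const.clm_comp (ContMDiffAt.clm_comp hξ contMDiffAt_const))
  refine (hnum.clm_comp hSi).congr_of_eventuallyEq ?_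
  filter_upwards [hAf, hchart, hSinv] with x hx hxc hxS
  have ha : ∀ v, a x v = (show E' →L[ℝ] ℂ from (ξ x).1)
      (chartFrame E' (f x₀) (f x) (A x v)) := fun v =>
    (congrArg (show E' →L[ℝ] ℂ from (ξ x).1) (hx v)).symm
  have hcomp : ((show E' →L[ℝ] ℂ from (ξ x).1).comp (chartFrame E' (f x₀) (f x))).comp (S x) =
      (a x).comp R₁ + iC.comp ((a x).comp R₂) := by
    ext w
    change (show E' →L[ℝ] ℂ from (ξ x).1) (chartFrame E' (f x₀) (f x)
      (A x (R₁ w) + Complex.I • A x (R₂ w))) = a x (R₁ w) + Complex.I * a x (R₂ w)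
    rw [map_add, chartFrame_I_smul hxc, map_add, ha, ha]
    exact congrArg (_ + ·) ((ξ x).2 _)
  rw [← hcomp, ContinuousLinearMap.comp_assoc, hxS.self_comp_inverse,
    ContinuousLinearMap.comp_id]

end ComplexFrames

end DoubleFibration

theorem mainTheorem8
    {EZ EX EM EXX EMM : Type*}
    [NormedAddCommGroup EZ] [NormedSpace ℂ EZ] [FiniteDimensional ℂ EZ]
    [NormedAddCommGroup EX] [NormedSpace ℝ EX] [FiniteDimensional ℝ EX]
    [NormedAddCommGroup EM] [NormedSpace ℝ EM] [FiniteDimensional ℝ EM]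
    [NormedAddCommGroup EXX] [NormedSpace ℂ EXX] [FiniteDimensional ℂ EXX]
    [NormedAddCommGroup EMM] [NormedSpace ℂ EMM] [FiniteDimensional ℂ EMM]
    {Z X M XX MM : Type*}
    [TopologicalSpace Z] [ChartedSpace EZ Z] [IsManifold 𝓘(ℂ, EZ) ω Z]
    [TopologicalSpace X] [ChartedSpace EX X] [IsManifold 𝓘(ℝ, EX) ∞ X]
    [TopologicalSpace M] [ChartedSpace EM M] [IsManifold 𝓘(ℝ, EM) ∞ M]
    [TopologicalSpace XX] [ChartedSpace EXX XX] [IsManifold 𝓘(ℂ, EXX) ω XX]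
    [TopologicalSpace MM] [ChartedSpace EMM MM] [IsManifold 𝓘(ℂ, EMM) ω MM]
    (η : X → Z) (τ : X → M) (μ : XX → Z) (ν : XX → MM) (ι : X → XX) (j : M → MM)
    (h : DoubleFibration.IsSmoothDoubleFibration EZ EX EM η τ)
    (_hH : DoubleFibration.IsHolomorphicDoubleFibration EZ EXX EMM μ ν)
    (_hC : DoubleFibration.IsComplexification EX EM EXX EMM η τ μ ν ι j) :
    ∃ Φ : ∀ x : X, DoubleFibration.VertForm10 EZ EXX μ (ι x) ≃ₗ[ℂ] h.MiddleCohomology x,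
      (∀ (x : X) (ξ : DoubleFibration.Form10 EXX (ι x)),
        ∃ hξ : h.complexSnd x (DoubleFibration.pullback ι x ξ.1) = 0,
          Φ x (DoubleFibration.restrict10 μ (ι x) ξ) =
            h.middleClass x (DoubleFibration.pullback ι x ξ.1) hξ) ∧
      ∀ (U : Set X), IsOpen U → ∀ s : (∀ x : X, DoubleFibration.VertForm10 EZ EXX μ (ι x)),
        DoubleFibration.IsSmoothVertSection (EX := EX) ι μ s U ↔
          h.IsSmoothSection (fun x => Φ x (s x)) U := by
  have hχ : ∀ x, ∃ e : DoubleFibration.VertForm10 EZ EXX μ (ι x) ≃ₗ[ℂ] h.MiddleCohomology x,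
      ∀ ξ : DoubleFibration.Form10 EXX (ι x), e (DoubleFibration.restrict10 μ (ι x) ξ) =
        h.middleClass x (DoubleFibration.pullback ι x ξ.1) (_hC.complexSnd_pullback _hH h x ξ) :=
    _hC.exists_equiv _hH h
  choose Φ hΦ using hχ
  refine ⟨Φ, fun x ξ => ⟨_, hΦ x ξ⟩, fun U _ s => ⟨fun hs x₀ hx₀ => ?_, fun hs x₀ hx₀ => ?_⟩⟩
  · obtain ⟨V, hV, hxV, ξ, hξ, hsξ⟩ := hs x₀ hx₀
    refine ⟨V, hV, hxV, fun x => DoubleFibration.pullback ι x (ξ x).1,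
      hξ.pullback _hC.contMDiff hV,
      fun x hx => ⟨_hC.complexSnd_pullback _hH h x (ξ x), ?_⟩⟩
    simp only [hsξ x hx, hΦ]
  · obtain ⟨V, hV, hxV, α, hα, hsα⟩ := hs x₀ hx₀
    -- The `(1,0)`-form on `𝕏` with pull-back `α x`, with the value `0` off `V`.
    have hξ : ∀ x, ∃ ξ : DoubleFibration.Form10 EXX (ι x),
        x ∈ V → DoubleFibration.pullback ι x ξ.1 = α x := fun x => by
      by_cases hx : x ∈ V
      · obtain ⟨hαx, -⟩ := hsα x hx
        obtain ⟨ξ, hξ⟩ := _hC.exists_pullback_eq _hH h x (α x) hαx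
        exact ⟨ξ, fun _ => hξ⟩
      · exact ⟨0, fun hx' => absurd hx' hx⟩
    choose ξ hξ using hξ
    refine ⟨V, hV, hxV, ξ, ?_, fun x hx => (Φ x).injective ?_⟩
    · refine DoubleFibration.isSmoothAlong_of_pullback _hC.contMDiff
        (_hC.exists_eq_add_smul _hH h) hV (hα.congr fun x hx => ?_)
      exact congrArg (TotalSpace.mk' (EX →L[ℝ] ℂ) x) (hξ x hx)
    · obtain ⟨hαx, hs'⟩ := hsα x hx
      refine hs'.trans (Eq.trans ?_ (hΦ x (ξ x)).symm)
      congr 1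
      exact (hξ x hx).symm
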